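/- Let $1<p<\infty$ and $L_p=L_p(\mathbb R)$ (complex-valued, Lebesgue measure). Let $H_p^+$ and $H_p^-$ be the Hardy spaces of the open upper and lower half-planes $\mathbb C^+$ and $\mathbb C^-$, identified through nontangential boundary values with subspaces of $L_p$, and let $P^+$ be the projection of $L_p$ onto $H_p^+$ parallel to $H_p^-$. Let $\sigma_p$ be the set of measurable functions $f:\mathbb R\to\mathbb C$ for which there is a non-zero $\phi\in H_p^+$ with $f\phi\in L_p$. For $f\in\sigma_p$ let $T_f$ be the (possibly unbounded) Toeplitz operator $$D(T_f)=\{\phi\in H_p^+ : f\phi\in L_p\},\qquad T_f\phi=P^+(f\phi),$$ so that $\ker T_f=\{\phi\in H_p^+: f\phi\in H_p^-\}$. For $c\in\mathbb R$ and $\alpha\in\mathbb R$ let $$r_c^\alpha(\xi)=\exp\Big(\alpha\log\frac{\xi-i}{\xi+i}\Big),\qquad \xi\in\mathbb R\setminus\{c\},$$ where $\log$ is the branch of the logarithm with $\log 1=0$ whose cut, the ray from $0$ to $\infty$ through $\frac{c-i}{c+i}$, meets the unit circle at that point. Let $\big(\frac{\xi+i}{\xi-c}\big)^{\alpha}$ denote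 the principal power; it is the boundary function of the branch holomorphic in $\mathbb C^+$ which tends to $1$ at $\infty$. **Theorem.** Let $f\in\sigma_p$, $c\in\mathbb R$, $0<\alpha<1$, and let $g=f\,r_c^{\alpha}$ almost everywhere. Then $D(T_g)=D(T_f)$ and $$\ker T_g=\Big[\Big(\frac{\xi+i}{\xi-c}\Big)^{\alpha}\ker T_f\Big]\cap D(T_g),$$ that is, $\phi\in\ker T_g$ if and only if $\phi\in D(T_g)$ and $\phi=\big(\frac{\xi+i}{\xi-c}\big)^{\alpha}k$ almost everywhere for some $k\in\ker T_f$. -/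

import Mathlib

open MeasureTheory Filter Topology
open scoped ENNReal NNReal

noncomputable section

namespace HardyToeplitz

/-- The open half-plane `{z : 0 < s * Im z}`: the upper half-plane for `s = 1`, the lower
half-plane for `s = -1`. -/
def halfPlane (s : ℝ) : Set ℂ := {z | 0 < s * z.im}

/-- The nontangential approach region (cone) of aperture `a` with vertex `x` on the real line,
inside `halfPlane s`. -/
def approachRegion (s a x : ℝ) : Set ℂ := {z | 0 < s * z.im ∧ |z.re - x| < a * (s * z.im)}

/-- `F` belongs to the Hardy space `H^p` of `halfPlane s` (holomorphic, with uniformly bounded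
`L^p` norms on the lines parallel to the boundary), and `f` is its nontangential boundary function
on the real line. -/
structure IsHardyWithBoundary (s : ℝ) (p : ℝ≥0∞) (F : ℂ → ℂ) (f : ℝ → ℂ) : Prop where
  holomorphic : DifferentiableOn ℂ F (halfPlane s)
  bounded : ∃ C : ℝ≥0, ∀ y : ℝ, 0 < s * y →
    eLpNorm (fun x : ℝ => F ((x : ℂ) + (y : ℂ) * Complex.I)) p volume ≤ (C : ℝ≥0∞)
  boundary : ∀ᵐ x : ℝ ∂(volume : Measure ℝ), ∀ a : ℝ, 0 < a →
    Tendsto F (𝓝[approachRegion s a x] (x : ℂ)) (𝓝 (f x))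

theorem IsHardyWithBoundary.aestronglyMeasurable {s : ℝ} {p : ℝ≥0∞} {F : ℂ → ℂ} {f : ℝ → ℂ}
    (h : IsHardyWithBoundary s p F f) {y : ℝ} (hy : 0 < s * y) :
    AEStronglyMeasurable (fun x : ℝ => F ((x : ℂ) + (y : ℂ) * Complex.I))
      (volume : Measure ℝ) := by
  have hc : Continuous (fun x : ℝ => F ((x : ℂ) + (y : ℂ) * Complex.I)) := by
    refine h.holomorphic.continuousOn.comp_continuous (by fun_prop) ?_
    intro x
    simpa [halfPlane] using hy
  exact hc.aestronglyMeasurable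

/-- The Hardy space `H_p` of `halfPlane s`, identified with the subspace of `L_p(ℝ)` consisting of
the nontangential boundary functions. -/
def hardySpace (s : ℝ) (p : ℝ≥0∞) : Submodule ℂ (Lp ℂ p (volume : Measure ℝ)) where
  carrier := {f | ∃ F : ℂ → ℂ, IsHardyWithBoundary s p F f}
  zero_mem' := by
    refine ⟨0, ?_, ⟨0, ?_⟩, ?_⟩
    · exact differentiableOn_const 0
    · intro y _
      have : (fun x : ℝ => (0 : ℂ → ℂ) ((x : ℂ) + (y : ℂ) * Complex.I)) = 0 := rfl
      rw [this, eLpNorm_zero]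
      exact zero_le
    · filter_upwards [Lp.coeFn_zero ℂ p (volume : Measure ℝ)] with x hx a _
      rw [hx]
      exact tendsto_const_nhds
  add_mem' := by
    rintro f g ⟨F, hF⟩ ⟨G, hG⟩
    obtain ⟨C, hC⟩ := hF.bounded
    obtain ⟨D, hD⟩ := hG.bounded
    refine ⟨F + G, hF.holomorphic.add hG.holomorphic, ?_, ?_⟩
    · refine ⟨(ENNReal.LpAddConst p * ((C : ℝ≥0∞) + D)).toNNReal, fun y hy => ?_⟩
      rw [ENNReal.coe_toNNReal (by
        exact ENNReal.mul_ne_top (ENNReal.LpAddConst_lt_top p).ne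
          (ENNReal.add_ne_top.2 ⟨ENNReal.coe_ne_top, ENNReal.coe_ne_top⟩))]
      refine le_trans (eLpNorm_add_le' (hF.aestronglyMeasurable hy)
        (hG.aestronglyMeasurable hy) p) ?_
      gcongr
      · exact hC y hy
      · exact hD y hy
    · filter_upwards [Lp.coeFn_add f g, hF.boundary, hG.boundary] with x hx h1 h2 a ha
      rw [hx]
      exact (h1 a ha).add (h2 a ha)
  smul_mem' := by
    rintro c f ⟨F, hF⟩
    obtain ⟨C, hC⟩ := hF.bounded
    refine ⟨c • F, hF.holomorphic.const_smul c, ⟨‖c‖₊ * C, fun y hy => ?_⟩, ?_⟩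
    · have : (fun x : ℝ => (c • F) ((x : ℂ) + (y : ℂ) * Complex.I))
          = c • (fun x : ℝ => F ((x : ℂ) + (y : ℂ) * Complex.I)) := rfl
      rw [this]
      refine le_trans eLpNorm_const_smul_le ?_
      rw [ENNReal.coe_mul]
      gcongr
      · exact le_rfl
      · exact hC y hy
    · filter_upwards [Lp.coeFn_smul c f, hF.boundary] with x hx h1 a ha
      rw [hx]
      exact (h1 a ha).const_smul c

/-- `H_p^+`, the Hardy space of the upper half-plane. -/
def hardyPlus (p : ℝ≥0∞) : Submodule ℂ (Lp ℂ p (volume : Measure ℝ)) := hardySpace 1 p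

/-- `H_p^-`, the Hardy space of the lower half-plane. -/
def hardyMinus (p : ℝ≥0∞) : Submodule ℂ (Lp ℂ p (volume : Measure ℝ)) := hardySpace (-1) p

/-- `u = P^+ h`, where `P^+` is the projection of `L_p` onto `H_p^+` parallel to `H_p^-`. -/
def IsRieszProj (p : ℝ≥0∞) (h u : Lp ℂ p (volume : Measure ℝ)) : Prop :=
  u ∈ hardyPlus p ∧ h - u ∈ hardyMinus p

/-- The class `σ_p` of symbols: (Lebesgue) measurable functions `g` on `ℝ` such that `g f₊ ∈ L_p`
for some nonzero `f₊ ∈ H_p^+`. -/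
def symbolClass (p : ℝ≥0∞) : Set (ℝ → ℂ) :=
  {g | AEMeasurable g (volume : Measure ℝ) ∧
    ∃ φ ∈ hardyPlus p, φ ≠ 0 ∧ MemLp (fun ξ : ℝ => g ξ * φ ξ) p volume}

/-- The domain `D(T_g) = {φ₊ ∈ H_p^+ : g φ₊ ∈ L_p}`. -/
def toeplitzDomain (p : ℝ≥0∞) (g : ℝ → ℂ) : Set (Lp ℂ p (volume : Measure ℝ)) :=
  {φ | φ ∈ hardyPlus p ∧ MemLp (fun ξ : ℝ => g ξ * φ ξ) p volume}

/-- The graph of the Toeplitz operator: `T_g φ = ψ` means `φ ∈ D(T_g)` and `ψ = P^+ (g φ)`. -/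
def toeplitzGraph (p : ℝ≥0∞) (g : ℝ → ℂ) :
    Set (Lp ℂ p (volume : Measure ℝ) × Lp ℂ p (volume : Measure ℝ)) :=
  {x | ∃ h : x.1 ∈ toeplitzDomain p g, IsRieszProj p (h.2.toLp _) x.2}

/-- The kernel of `T_g`: all `φ ∈ D(T_g)` with `T_g φ = 0`. -/
def toeplitzKer (p : ℝ≥0∞) (g : ℝ → ℂ) : Set (Lp ℂ p (volume : Measure ℝ)) :=
  {φ | (φ, 0) ∈ toeplitzGraph p g}

/-- The set `m K` of all elements of `L_p` of the form `m k` with `k ∈ K`. -/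
def mulSet {p : ℝ≥0∞} (m : ℝ → ℂ) (K : Set (Lp ℂ p (volume : Measure ℝ))) :
    Set (Lp ℂ p (volume : Measure ℝ)) :=
  {φ | ∃ k ∈ K, φ =ᵐ[volume] fun ξ : ℝ => m ξ * k ξ}

/-- For `z₀ ≠ 1` on the unit circle: the branch of the logarithm with cut along the ray from `0`
to `∞` through `z₀`, normalized by `log 1 = 0`. -/
def cutLog (z₀ z : ℂ) : ℂ := Complex.log (-z / z₀) - Complex.log (-1 / z₀)

/-- `r_c^α(ξ) = exp (α log ((ξ - i)/(ξ + i)))`, where the cut of the logarithm meets the unit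
circle at `(c - i)/(c + i)` and `log 1 = 0`. -/
def rPow (c : ℝ) (α : ℂ) (ξ : ℝ) : ℂ :=
  Complex.exp (α * cutLog (((c : ℂ) - Complex.I) / ((c : ℂ) + Complex.I))
    (((ξ : ℂ) - Complex.I) / ((ξ : ℂ) + Complex.I)))

/-- `((ξ + i)/(ξ - c))^α` with the principal power. For `Im z ≥ 0`, `z ≠ c`, the point
`(z + i)/(z - c)` never lies on `(-∞, 0]`, so this is the boundary function of the
holomorphic branch on the upper half-plane that tends to `1` at infinity. -/
def factorPow (c : ℝ) (α : ℂ) (ξ : ℝ) : ℂ :=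
  (((ξ : ℂ) + Complex.I) / ((ξ : ℂ) - (c : ℂ))) ^ α

end HardyToeplitz

end

noncomputable section

namespace HardyToeplitz

/-! Write b₊ and b₋ for the boundary functions of ((z + i)/(z - c))^α and ((z - i)/(z - c))^α,
holomorphic in the upper and lower half-planes. On the line |b₊| = |b₋| and r_c^α = b₋/b₊
(`rPow_mul_branchPow`), so the symbol r_c^α is unimodular and the domains agree.

If φ = b₊k, then gφ = b₋·(fk), and the kernel condition moves between φ and k by multiplying or
dividing by b₊ in H⁺ and b₋ in H⁻. Division is easy: 1/b₊ and 1/b₋ are bounded and holomorphic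
(`IsHardyWithBoundary.inv_branchPow_mul`). This gives k = φ/b₊ from φ.

Multiplication by b₋ is the real content, since b₋ blows up at c. If fk lies in H⁻ and b₋fk lies in
L_p, then b₋fk lies in H⁻ (`IsHardyWithBoundary.branchPow_mul`), a Smirnov-type statement. The
functions b₋(z - iε) are bounded, and on the line they are at most 2^α|b₋|; the norms of the
products on horizontal lines are controlled by their boundary norms, and Fatou's lemma lets ε tend
to 0. The control by boundary norms (`IsHardyWithBoundary.eLpNorm_le`) comes from the Poisson
representation, which is proved here from Cauchy's theorem. -/

/-! ### The branches ((z ± i)/(z - c))^α: holomorphy and size. -/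

/-- The branch `((z + s i)/(z - c))^α`, holomorphic on `halfPlane s` when `s = ±1`. -/
def branchPow (s c α : ℝ) (z : ℂ) : ℂ := ((z + s * Complex.I) / (z - c)) ^ (α : ℂ)

/-- The Möbius map sends c to ∞, ∞ to 1 and -si to 0, so the image of the half-plane is a half-plane
with 1 on its boundary and 0 outside its closure; such a closed half-plane misses (-∞, 0]. The
computation checks that where the quotient is real it is positive. -/
theorem div_sub_mem_slitPlane {s c : ℝ} (hs : s ^ 2 = 1) {z : ℂ} (hz : 0 ≤ s * z.im)
    (hzc : z ≠ c) : (z + s * Complex.I) / (z - c) ∈ Complex.slitPlane := by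
  have hzc' : z - c ≠ 0 := sub_ne_zero.2 hzc
  have hN : 0 < Complex.normSq (z - c) := Complex.normSq_pos.2 hzc'
  have hre : ((z + s * Complex.I) / (z - c)).re =
      (z.re * (z.re - c) + (z.im + s) * z.im) / Complex.normSq (z - c) := by
    simp [Complex.div_re, add_div]
    ring
  have him : ((z + s * Complex.I) / (z - c)).im =
      ((z.im + s) * (z.re - c) - z.re * z.im) / Complex.normSq (z - c) := by
    simp [Complex.div_im, sub_div]
  rw [Complex.mem_slitPlane_iff, hre, him]
  by_cases h : (z.im + s) * (z.re - c) - z.re * z.im = 0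
  · left
    have hu : z.re - c = s * c * z.im := by
      linear_combination s * h - (z.re - c) * hs
    have hy : z.im ≠ 0 := by
      intro hy
      rw [hy, mul_zero, sub_eq_zero] at hu
      exact hzc (Complex.ext (by simpa using hu) (by simpa using hy))
    have hs0 : s ≠ 0 := by
      rintro rfl
      norm_num at hs
    have hpos : 0 < s * z.im := lt_of_le_of_ne hz (mul_ne_zero hs0 hy).symm
    refine div_pos ?_ hN
    have : z.re * (z.re - c) + (z.im + s) * z.im = (1 + c ^ 2) * (z.im ^ 2 + s * z.im) := by
      have h2 : z.re = c + s * c * z.im := by linarith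
      rw [h2]
      linear_combination (c ^ 2 * z.im ^ 2) * hs
    rw [this]
    positivity
  · right
    exact div_ne_zero h hN.ne'

theorem norm_branchPow (s c α : ℝ) (z : ℂ) :
    ‖branchPow s c α z‖ = (‖z + s * Complex.I‖ / ‖z - c‖) ^ α := by
  rw [branchPow, Complex.norm_cpow_real, norm_div]

theorem differentiableAt_branchPow {s c : ℝ} (α : ℝ) (hs : s ^ 2 = 1) {z : ℂ}
    (hz : 0 ≤ s * z.im) (hzc : z ≠ c) : DifferentiableAt ℂ (branchPow s c α) z := by
  refine DifferentiableAt.cpow ?_ (differentiableAt_const _) (div_sub_mem_slitPlane hs hz hzc)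
  exact DifferentiableAt.div (by fun_prop) (by fun_prop) (sub_ne_zero.2 hzc)

theorem branchPow_ne_zero {s c : ℝ} (α : ℝ) (hs : s ^ 2 = 1) {z : ℂ}
    (hz : 0 ≤ s * z.im) (hzc : z ≠ c) : branchPow s c α z ≠ 0 := by
  rw [branchPow, Complex.cpow_ne_zero_iff]
  exact Or.inl (Complex.slitPlane_ne_zero (div_sub_mem_slitPlane hs hz hzc))

theorem ne_ofReal_of_mem_halfPlane {s : ℝ} {z : ℂ} (hz : z ∈ halfPlane s) (c : ℝ) : z ≠ c := by
  rintro rfl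
  simp [halfPlane] at hz

theorem one_le_norm_add {s : ℝ} (hs : s ^ 2 = 1) {z : ℂ} (hz : 0 ≤ s * z.im) :
    1 ≤ ‖z + s * Complex.I‖ := by
  have h := Complex.abs_im_le_norm (z + s * Complex.I)
  have h1 : (z + s * Complex.I).im = z.im + s := by simp
  rw [h1] at h
  refine le_trans ?_ h
  rw [← abs_one, ← sq_le_sq]
  nlinarith [sq_nonneg z.im]

/-- Triangle inequality through c + si, using |z + si| ≥ 1. The point z = c need not be excluded:
there the inverted ratio is 0. -/
theorem norm_inv_branchPow_le {s c α : ℝ} (hs : s ^ 2 = 1) (hα : 0 ≤ α) {z : ℂ}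
    (hz : 0 ≤ s * z.im) :
    ‖(branchPow s c α z)⁻¹‖ ≤ (1 + ‖(c : ℂ) + s * Complex.I‖) ^ α := by
  have h1 := one_le_norm_add hs hz
  rw [norm_inv, norm_branchPow, ← Real.inv_rpow (by positivity), inv_div]
  refine Real.rpow_le_rpow (by positivity) ?_ hα
  rw [div_le_iff₀ (by linarith)]
  have h2 : ‖z - c‖ ≤ ‖z + s * Complex.I‖ + ‖(c : ℂ) + s * Complex.I‖ := by
    refine le_trans (le_of_eq ?_) (norm_sub_le _ _)
    congr 1
    ring
  nlinarith [norm_nonneg ((c : ℂ) + s * Complex.I)]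

theorem norm_branchPow_le {s c α δ : ℝ} (hα : 0 ≤ α) (hδ : 0 < δ) {z : ℂ}
    (hz : δ ≤ ‖z - c‖) :
    ‖branchPow s c α z‖ ≤ (1 + ‖(c : ℂ) + s * Complex.I‖ / δ) ^ α := by
  rw [norm_branchPow]
  refine Real.rpow_le_rpow (by positivity) ?_ hα
  have h2 : ‖z + s * Complex.I‖ ≤ ‖z - c‖ + ‖(c : ℂ) + s * Complex.I‖ := by
    refine le_trans (le_of_eq ?_) (norm_add_le _ _)
    congr 1
    ring
  rw [div_le_iff₀ (by linarith)]
  have h3 : ‖(c : ℂ) + s * Complex.I‖ ≤ ‖(c : ℂ) + s * Complex.I‖ / δ * ‖z - c‖ := by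
    rw [div_mul_eq_mul_div, le_div_iff₀ hδ]
    gcongr
  linarith

/-- Moving a boundary point into the half-plane increases `|branchPow|` by a bounded factor. -/
theorem norm_branchPow_shift_le {s c α ε : ℝ} (hs : s ^ 2 = 1) (hα : 0 ≤ α) (hε : 0 ≤ ε)
    (hε1 : ε ≤ 1) {x : ℝ} (hx : x ≠ c) :
    ‖branchPow s c α (x + (s * ε : ℝ) * Complex.I)‖ ≤ 2 ^ α * ‖branchPow s c α x‖ := by
  rw [norm_branchPow, norm_branchPow, ← Real.mul_rpow (by positivity) (by positivity)]
  refine Real.rpow_le_rpow (by positivity) ?_ hα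
  have hxc : 0 < ‖(x : ℂ) - c‖ := by
    rw [norm_pos_iff, sub_ne_zero]
    exact_mod_cast hx
  rw [← mul_div_assoc]
  -- The numerator at most doubles because |x + si| ≥ 1 ≥ ε; the denominator does not shrink because
  -- a vertical shift keeps the real part x - c.
  gcongr
  · have h1 := one_le_norm_add (z := (x : ℂ)) hs (by simp)
    have h2 : ‖((s * ε : ℝ) : ℂ) * Complex.I‖ ≤ 1 := by
      rw [norm_mul, Complex.norm_I, mul_one, Complex.norm_real, Real.norm_eq_abs, abs_mul,
        abs_of_nonneg hε]
      have : |s| = 1 := by rw [← sq_eq_sq₀ (abs_nonneg _) zero_le_one, sq_abs, hs]; norm_num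
      rw [this]; linarith
    calc _ = ‖((x : ℂ) + s * Complex.I) + ((s * ε : ℝ) : ℂ) * Complex.I‖ := by congr 1; ring
      _ ≤ _ := norm_add_le _ _
      _ ≤ _ := by linarith
  · have h := Complex.abs_re_le_norm ((x : ℂ) + (s * ε : ℝ) * Complex.I - c)
    have h1 : ((x : ℂ) + (s * ε : ℝ) * Complex.I - c).re = x - c := by simp
    rw [h1] at h
    refine le_trans (le_of_eq ?_) h
    rw [← Complex.ofReal_sub, Complex.norm_real, Real.norm_eq_abs]

theorem factorPow_eq_branchPow (c α ξ : ℝ) : factorPow c (α : ℂ) ξ = branchPow 1 c α ξ := by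
  simp [factorPow, branchPow]

/-! ### Factorization of r_c^α on the real line. -/

theorem add_I_eq_sqrt_mul_exp (x : ℝ) :
    (x : ℂ) + Complex.I =
      (√(1 + x ^ 2) : ℝ) * Complex.exp ((Real.pi / 2 - Real.arctan x : ℝ) * Complex.I) := by
  have h : 0 < √(1 + x ^ 2) := Real.sqrt_pos.2 (by positivity)
  apply Complex.ext
  · rw [Complex.re_ofReal_mul, Complex.exp_ofReal_mul_I_re, Real.cos_pi_div_two_sub,
      Real.sin_arctan]
    simp
    field_simp
  · rw [Complex.im_ofReal_mul, Complex.exp_ofReal_mul_I_im, Real.sin_pi_div_two_sub,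
      Real.cos_arctan]
    simp
    field_simp

theorem sub_I_eq_sqrt_mul_exp (x : ℝ) :
    (x : ℂ) - Complex.I =
      (√(1 + x ^ 2) : ℝ) * Complex.exp (-(Real.pi / 2 - Real.arctan x : ℝ) * Complex.I) := by
  have h : 0 < √(1 + x ^ 2) := Real.sqrt_pos.2 (by positivity)
  rw [← Complex.ofReal_neg]
  apply Complex.ext
  · rw [Complex.re_ofReal_mul, Complex.exp_ofReal_mul_I_re, Real.cos_neg,
      Real.cos_pi_div_two_sub, Real.sin_arctan]
    simp
    field_simp
  · rw [Complex.im_ofReal_mul, Complex.exp_ofReal_mul_I_im, Real.sin_neg,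
      Real.sin_pi_div_two_sub, Real.cos_arctan]
    simp
    field_simp

theorem log_ofReal_mul_exp_mul_I {r t : ℝ} (hr : 0 < r) (h1 : -Real.pi < t) (h2 : t ≤ Real.pi) :
    Complex.log ((r : ℂ) * Complex.exp (t * Complex.I)) = (Real.log r : ℝ) + t * Complex.I := by
  rw [Complex.log_ofReal_mul hr (Complex.exp_ne_zero _), Complex.log_exp (by simpa) (by simpa)]

theorem log_exp_ofReal_mul_I {t : ℝ} (h1 : -Real.pi < t) (h2 : t ≤ Real.pi) :
    Complex.log (Complex.exp (t * Complex.I)) = t * Complex.I :=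
  Complex.log_exp (by simpa) (by simpa)

/-- With θ and γ in (0, π) the arguments of ξ + i and c + i, both sides equal -2iθ for ξ > c and
2i(π - θ) for ξ < c: the cut is placed so that the logarithm jumps exactly where ξ - c changes sign.
The moduli cancel since |ξ - i| = |ξ + i|. -/
theorem cutLog_eq_log_sub_log {c ξ : ℝ} (h : ξ ≠ c) :
    cutLog (((c : ℂ) - Complex.I) / ((c : ℂ) + Complex.I))
      (((ξ : ℂ) - Complex.I) / ((ξ : ℂ) + Complex.I)) =
    Complex.log (((ξ : ℂ) - Complex.I) / (ξ - c)) -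
      Complex.log (((ξ : ℂ) + Complex.I) / (ξ - c)) := by
  set γ := Real.pi / 2 - Real.arctan c with hγ
  set θ := Real.pi / 2 - Real.arctan ξ with hθ
  have hγ1 : 0 < γ := by linarith [Real.arctan_lt_pi_div_two c]
  have hγ2 : γ < Real.pi := by linarith [Real.neg_pi_div_two_lt_arctan c]
  have hθ1 : 0 < θ := by linarith [Real.arctan_lt_pi_div_two ξ]
  have hθ2 : θ < Real.pi := by linarith [Real.neg_pi_div_two_lt_arctan ξ]
  have hC : ((√(1 + c ^ 2) : ℝ) : ℂ) ≠ 0 := by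
    exact_mod_cast (Real.sqrt_pos.2 (by positivity)).ne'
  have hX0 : 0 < √(1 + ξ ^ 2) := Real.sqrt_pos.2 (by positivity)
  have hX : ((√(1 + ξ ^ 2) : ℝ) : ℂ) ≠ 0 := by exact_mod_cast hX0.ne'
  have hpi : Complex.exp ((Real.pi : ℂ) * Complex.I) = -1 := Complex.exp_pi_mul_I
  have hnpi : Complex.exp (-(Real.pi : ℂ) * Complex.I) = -1 := by
    rw [neg_mul, Complex.exp_neg, hpi]; norm_num
  have e0 : -1 / (((c : ℂ) - Complex.I) / ((c : ℂ) + Complex.I)) =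
      Complex.exp ((2 * γ - Real.pi : ℝ) * Complex.I) := by
    rw [add_I_eq_sqrt_mul_exp, sub_I_eq_sqrt_mul_exp, ← hγ, mul_div_mul_left _ _ hC,
      ← Complex.exp_sub, ← hnpi, ← Complex.exp_sub]
    congr 1
    push_cast
    ring
  unfold cutLog
  rw [e0, log_exp_ofReal_mul_I (by linarith) (by linarith)]
  -- The sign -1 is written as exp(iσ) with σ = π for ξ < c and σ = -π for ξ > c, which puts the
  -- angle in the principal range.
  have key : ∀ σ : ℝ, Complex.exp ((σ : ℂ) * Complex.I) = -1 →
      -(((ξ : ℂ) - Complex.I) / ((ξ : ℂ) + Complex.I)) /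
        (((c : ℂ) - Complex.I) / ((c : ℂ) + Complex.I)) =
      Complex.exp ((2 * γ - 2 * θ + σ : ℝ) * Complex.I) := by
    intro σ hσ
    rw [add_I_eq_sqrt_mul_exp c, sub_I_eq_sqrt_mul_exp c, ← hγ, mul_div_mul_left _ _ hC,
      add_I_eq_sqrt_mul_exp ξ, sub_I_eq_sqrt_mul_exp ξ, ← hθ, mul_div_mul_left _ _ hX,
      ← Complex.exp_sub, ← Complex.exp_sub, neg_eq_neg_one_mul, ← hσ, ← Complex.exp_add,
      ← Complex.exp_sub]
    congr 1
    push_cast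
    ring
  rcases lt_or_gt_of_ne h with hlt | hgt
  · have hθγ : γ < θ := by linarith [Real.arctan_strictMono hlt]
    have hr : 0 < √(1 + ξ ^ 2) / (c - ξ) := div_pos hX0 (by linarith)
    have hcx : (c : ℂ) - ξ ≠ 0 := by
      rw [sub_ne_zero]
      exact_mod_cast hlt.ne'
    have hxc : (ξ : ℂ) - c ≠ 0 := by
      rw [sub_ne_zero]
      exact_mod_cast hlt.ne
    have e1 : ((ξ : ℂ) + Complex.I) / (ξ - c) = ((√(1 + ξ ^ 2) / (c - ξ) : ℝ) : ℂ) *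
        Complex.exp ((θ - Real.pi : ℝ) * Complex.I) := by
      rw [add_I_eq_sqrt_mul_exp ξ, ← hθ]
      push_cast
      rw [sub_mul, Complex.exp_sub, hpi]
      field_simp
      ring
    have e2 : ((ξ : ℂ) - Complex.I) / (ξ - c) = ((√(1 + ξ ^ 2) / (c - ξ) : ℝ) : ℂ) *
        Complex.exp ((-θ + Real.pi : ℝ) * Complex.I) := by
      rw [sub_I_eq_sqrt_mul_exp ξ, ← hθ]
      push_cast
      rw [add_mul, Complex.exp_add, hpi]
      field_simp
      ring
    rw [key Real.pi hpi, log_exp_ofReal_mul_I (by linarith) (by linarith), e1, e2,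
      log_ofReal_mul_exp_mul_I hr (by linarith) (by linarith),
      log_ofReal_mul_exp_mul_I hr (by linarith) (by linarith)]
    push_cast
    ring
  · have hθγ : θ < γ := by linarith [Real.arctan_strictMono hgt]
    have hr : 0 < √(1 + ξ ^ 2) / (ξ - c) := div_pos hX0 (by linarith)
    have e1 : ((ξ : ℂ) + Complex.I) / (ξ - c) = ((√(1 + ξ ^ 2) / (ξ - c) : ℝ) : ℂ) *
        Complex.exp ((θ : ℝ) * Complex.I) := by
      rw [add_I_eq_sqrt_mul_exp ξ, ← hθ]
      push_cast
      ring
    have e2 : ((ξ : ℂ) - Complex.I) / (ξ - c) = ((√(1 + ξ ^ 2) / (ξ - c) : ℝ) : ℂ) *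
        Complex.exp ((-θ : ℝ) * Complex.I) := by
      rw [sub_I_eq_sqrt_mul_exp ξ, ← hθ]
      push_cast
      ring
    rw [key (-Real.pi) (by simp), log_exp_ofReal_mul_I (by linarith) (by linarith),
      e1, e2, log_ofReal_mul_exp_mul_I hr (by linarith) (by linarith),
      log_ofReal_mul_exp_mul_I hr (by linarith) (by linarith)]
    push_cast
    ring

/-- The factorization `r_c^α = ((ξ - i)/(ξ - c))^α / ((ξ + i)/(ξ - c))^α`. -/
theorem rPow_mul_branchPow {c ξ : ℝ} (α : ℝ) (h : ξ ≠ c) :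
    rPow c (α : ℂ) ξ * branchPow 1 c α ξ = branchPow (-1) c α ξ := by
  have hc : (ξ : ℂ) ≠ c := by exact_mod_cast h
  have h1 := Complex.slitPlane_ne_zero
    (div_sub_mem_slitPlane (s := 1) (by norm_num) (by simp) hc)
  have h2 := Complex.slitPlane_ne_zero
    (div_sub_mem_slitPlane (s := -1) (by norm_num) (by simp) hc)
  rw [rPow, cutLog_eq_log_sub_log h, branchPow, branchPow, Complex.cpow_def_of_ne_zero h1,
    Complex.cpow_def_of_ne_zero h2, ← Complex.exp_add]
  congr 1
  push_cast
  rw [one_mul, neg_one_mul, ← sub_eq_add_neg]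
  ring

theorem norm_rPow {c ξ : ℝ} (α : ℝ) (h : ξ ≠ c) : ‖rPow c (α : ℂ) ξ‖ = 1 := by
  have hc : (ξ : ℂ) ≠ c := by exact_mod_cast h
  have h0 := branchPow_ne_zero (s := 1) α (by norm_num) (by simp) hc
  have h1 := congrArg norm (rPow_mul_branchPow α h)
  have h2 : ‖branchPow (-1) c α ξ‖ = ‖branchPow 1 c α ξ‖ := by
    rw [norm_branchPow, norm_branchPow, ← RCLike.norm_conj ((ξ : ℂ) + ((-1 : ℝ) : ℂ) * Complex.I)]
    simp
  rw [norm_mul, h2] at h1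
  exact mul_eq_right₀ (norm_ne_zero_iff.2 h0) |>.1 h1

theorem measurable_rPow (c : ℝ) (α : ℂ) : Measurable (rPow c α) := by
  unfold rPow cutLog
  fun_prop

theorem measurable_branchPow (s c α : ℝ) : Measurable (branchPow s c α) := by
  unfold branchPow
  fun_prop

/-! ### The Poisson formula for bounded functions. -/

theorem integral_cauchyMeasure_zero_one (h : ℝ → ℂ) :
    ∫ t, h t ∂(ProbabilityTheory.cauchyMeasure 0 1) =
      (Real.pi : ℂ)⁻¹ * ∫ t : ℝ, h t * ((1 + t ^ 2)⁻¹ : ℝ) := by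
  rw [ProbabilityTheory.cauchyMeasure_of_scale_ne_zero 0 one_ne_zero,
    integral_withDensity_eq_integral_toReal_smul
      (ProbabilityTheory.measurable_cauchyPDF 0 1)
      (ae_of_all _ fun x => by simp [ProbabilityTheory.cauchyPDF_def]), ← integral_const_mul]
  congr 1
  ext t
  rw [ProbabilityTheory.cauchyPDF_def, ENNReal.toReal_ofReal
    (ProbabilityTheory.cauchyPDF_pos 0 one_ne_zero t).le, ProbabilityTheory.cauchyPDFReal_def']
  simp [Complex.real_smul]
  ring

/-- The Poisson formula at the point `i` for bounded holomorphic functions which are continuous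
up to the real line. -/
theorem integral_cauchyMeasure_eq {H : ℂ → ℂ} {C : ℝ} (hc : ContinuousOn H {z | 0 ≤ z.im})
    (hd : DifferentiableOn ℂ H {z | 0 < z.im}) (hb : ∀ z : ℂ, 0 ≤ z.im → ‖H z‖ ≤ C) :
    ∫ t : ℝ, H t ∂(ProbabilityTheory.cauchyMeasure 0 1) = H Complex.I := by
  have hC : 0 ≤ C := (norm_nonneg _).trans (hb 0 (by simp))
  have hopen : IsOpen {z : ℂ | 0 < z.im} := isOpen_lt continuous_const Complex.continuous_im
  have hI : {z : ℂ | 0 < z.im} ∈ 𝓝 Complex.I := hopen.mem_nhds (by simp)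
  have hI' : {z : ℂ | 0 ≤ z.im} ∈ 𝓝 Complex.I :=
    mem_of_superset hI fun z (hz : 0 < z.im) => hz.le
  have hne : ∀ z : ℂ, 0 ≤ z.im → z + Complex.I ≠ 0 := by
    intro z hz h
    have := congrArg Complex.im h
    simp at this
    linarith
  -- G is (H(z) - H(i))/(z² + 1) with the singularity at i removed by `dslope`; the formula amounts
  -- to the vanishing of its integral over the real line.
  set G : ℂ → ℂ := fun z => dslope H Complex.I z / (z + Complex.I) with hG
  have hGc : ContinuousOn G {z | 0 ≤ z.im} :=
    ((continuousOn_dslope hI').2 ⟨hc, (hd _ (by simp)).differentiableAt hI⟩).div (by fun_prop)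
      fun z hz => hne z hz
  have hGd : DifferentiableOn ℂ G {z | 0 < z.im} :=
    ((Complex.differentiableOn_dslope hI).2 hd).div (by fun_prop) fun z hz => hne z (le_of_lt hz)
  have hGeq : ∀ z : ℂ, z ≠ Complex.I → G z = (H z - H Complex.I) / (z ^ 2 + 1) := by
    intro z hz
    rw [hG]
    simp only
    rw [dslope_of_ne _ hz, slope_def_field, div_div]
    congr 1
    linear_combination (-1 : ℂ) * Complex.I_sq
  have hGb : ∀ R : ℝ, 2 ≤ R → ∀ z : ℂ, 0 ≤ z.im → R ≤ ‖z‖ → ‖G z‖ ≤ 2 * C / (R ^ 2 - 1) := by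
    intro R hR z hz hzR
    have hzI : z ≠ Complex.I := by
      rintro rfl
      rw [Complex.norm_I] at hzR
      linarith
    rw [hGeq z hzI, norm_div]
    have h1 : ‖H z - H Complex.I‖ ≤ 2 * C := by
      refine (norm_sub_le _ _).trans ?_
      linarith [hb z hz, hb Complex.I (by simp)]
    have h2 : R ^ 2 - 1 ≤ ‖z ^ 2 + 1‖ := by
      have h3 := norm_sub_norm_le (z ^ 2) (-1)
      rw [sub_neg_eq_add, norm_neg, norm_one, norm_pow] at h3
      nlinarith
    have h4 : 0 < R ^ 2 - 1 := by nlinarith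
    gcongr
  have hGt : ∀ t : ℝ, G t = (H t - H Complex.I) * ((1 + t ^ 2)⁻¹ : ℝ) := by
    intro t
    rw [hGeq]
    · push_cast
      rw [add_comm, div_eq_mul_inv]
    · intro h
      have := congrArg Complex.im h
      simp at this
  have hHt : Continuous fun t : ℝ => H t :=
    hc.comp_continuous Complex.continuous_ofReal fun t => by simp
  have hint1 : Integrable fun t : ℝ => (((1 + t ^ 2)⁻¹ : ℝ) : ℂ) :=
    integrable_inv_one_add_sq.ofReal
  have hintH : Integrable fun t : ℝ => H t * ((1 + t ^ 2)⁻¹ : ℝ) :=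
    hint1.bdd_mul hHt.aestronglyMeasurable (ae_of_all _ fun t => hb t (by simp))
  have hintc : Integrable fun t : ℝ => H Complex.I * ((1 + t ^ 2)⁻¹ : ℝ) := hint1.const_mul _
  have hGint : Integrable fun t : ℝ => G t := by
    have : (fun t : ℝ => G t) = fun t : ℝ =>
        H t * ((1 + t ^ 2)⁻¹ : ℝ) - H Complex.I * ((1 + t ^ 2)⁻¹ : ℝ) := by
      ext t
      rw [hGt, sub_mul]
    rw [this]
    exact hintH.sub hintc
  have hlim := intervalIntegral_tendsto_integral hGint tendsto_neg_atTop_atBot tendsto_id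
  have hzero : Tendsto (fun R : ℝ => ∫ t in (-R)..R, G t) atTop (𝓝 0) := by
    have hbound : ∀ᶠ R : ℝ in atTop, ‖∫ t in (-R)..R, G t‖ ≤ 8 * C / (R - R⁻¹) := by
      filter_upwards [eventually_ge_atTop 2] with R hR
      -- Cauchy's theorem on [-R, R] × [0, R]. The three sides off the real line have total length
      -- 4R and |G| is O(R⁻²) on them.
      have hrect := Complex.integral_boundary_rect_eq_zero_of_differentiable_on_off_countable
        G (-R : ℝ) (R + R * Complex.I) ∅ Set.countable_empty
        (hGc.mono fun z hz => by
          have := hz.2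
          simp only [Complex.ofReal_im, Complex.add_im, Complex.mul_im, Complex.ofReal_re,
            Complex.I_im, Complex.I_re, mul_one, mul_zero, zero_add, add_zero] at this
          rw [Set.mem_preimage, Set.uIcc_of_le (by linarith)] at this
          exact this.1)
        (fun z hz => by
          have := hz.1.2
          simp only [Complex.ofReal_im, Complex.add_im, Complex.mul_im, Complex.ofReal_re,
            Complex.I_im, Complex.I_re, mul_one, mul_zero, zero_add, add_zero] at this
          rw [Set.mem_preimage, min_eq_left (by linarith)] at this
          exact (hGd z this.1).differentiableAt (hopen.mem_nhds this.1))
      simp only [Complex.ofReal_im, Complex.add_im, Complex.mul_im, Complex.ofReal_re,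
        Complex.I_im, Complex.I_re, mul_one, mul_zero, zero_add, add_zero, Complex.add_re,
        Complex.mul_re, Complex.ofReal_zero, zero_mul, sub_self] at hrect
      set B := 2 * C / (R ^ 2 - 1) with hB
      have b1 : ‖∫ x : ℝ in (-R)..R, G (x + R * Complex.I)‖ ≤ B * |R - (-R)| := by
        refine intervalIntegral.norm_integral_le_of_norm_le_const fun x _ => ?_
        refine hGb R hR _ (by simp; linarith) ?_
        have := Complex.abs_im_le_norm (x + R * Complex.I)
        simp at this
        exact (le_abs_self _).trans this
      have b2 : ∀ r : ℝ, R ≤ |r| → ‖∫ y : ℝ in (0)..R, G (r + y * Complex.I)‖ ≤ B * |R - 0| := by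
        intro r hr
        refine intervalIntegral.norm_integral_le_of_norm_le_const fun y hy => ?_
        rw [Set.uIoc_of_le (by linarith)] at hy
        refine hGb R hR _ (by simp; linarith [hy.1]) ?_
        have := Complex.abs_re_le_norm (r + y * Complex.I)
        simp at this
        exact hr.trans this
      have b3 := b2 R (le_abs_self R)
      have b4 := b2 (-R) (by rw [abs_neg]; exact le_abs_self R)
      have hR0 : 0 < R := by linarith
      rw [abs_of_pos (by linarith)] at b1 b3 b4
      have heq : ∫ t in (-R)..R, G t = (∫ x : ℝ in (-R)..R, G (x + R * Complex.I)) -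
          Complex.I • (∫ y : ℝ in (0)..R, G (R + y * Complex.I)) +
          Complex.I • (∫ y : ℝ in (0)..R, G ((-R : ℝ) + y * Complex.I)) := by
        linear_combination hrect
      rw [heq]
      refine (norm_add_le _ _).trans ?_
      refine (add_le_add_left (norm_sub_le _ _) _).trans ?_
      rw [norm_smul, norm_smul, Complex.norm_I, one_mul, one_mul]
      have h4 : 0 < R ^ 2 - 1 := by nlinarith
      have : 8 * C / (R - R⁻¹) = 4 * (B * R) := by
        have : R - R⁻¹ = (R ^ 2 - 1) / R := by field_simp
        rw [this, hB]
        field_simp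
        ring
      rw [this]
      linarith
    refine squeeze_zero_norm' hbound ?_
    refine Tendsto.div_atTop tendsto_const_nhds ?_
    simp_rw [sub_eq_add_neg]
    exact tendsto_id.atTop_add tendsto_inv_atTop_zero.neg
  have hG0 : ∫ t : ℝ, G t = 0 := tendsto_nhds_unique hlim hzero
  have hsub : (∫ t : ℝ, H t * ((1 + t ^ 2)⁻¹ : ℝ)) - H Complex.I * Real.pi = 0 := by
    rw [← hG0, ← integral_univ_inv_one_add_sq, ← integral_complex_ofReal, ← integral_const_mul,
      ← integral_sub hintH hintc]
    congr 1
    ext t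
    rw [hGt, sub_mul]
  rw [integral_cauchyMeasure_zero_one, sub_eq_zero.1 hsub]
  have : (Real.pi : ℂ) ≠ 0 := by exact_mod_cast Real.pi_ne_zero
  field_simp

/-! ### The Poisson representation of Hardy functions and control by boundary norms. -/

theorem isOpen_halfPlane (s : ℝ) : IsOpen (halfPlane s) :=
  isOpen_lt continuous_const (continuous_const.mul Complex.continuous_im)

theorem mem_halfPlane_one {z : ℂ} : z ∈ halfPlane 1 ↔ 0 < z.im := by
  simp [halfPlane]

theorem eLpNorm_comp_add_left {p : ℝ≥0∞} {h : ℝ → ℂ} (hh : AEStronglyMeasurable h volume)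
    (a : ℝ) : eLpNorm (fun x => h (a + x)) p volume = eLpNorm h p volume :=
  eLpNorm_comp_measurePreserving hh (measurePreserving_add_left volume a)

theorem continuous_horizontal {F : ℂ → ℂ} (hF : DifferentiableOn ℂ F (halfPlane 1)) {w : ℂ}
    (hw : 0 < w.im) : Continuous fun t : ℝ => F (w + t) :=
  hF.continuousOn.comp_continuous (by fun_prop) fun t => by simpa [halfPlane] using hw

/-- Hölder on an interval of length at most 1, whose length factor is at most 1. -/
theorem norm_intervalIntegral_horizontal_le {p : ℝ≥0∞} (hp1 : 1 ≤ p) {F : ℂ → ℂ}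
    (hF : DifferentiableOn ℂ F (halfPlane 1)) {C : ℝ≥0}
    (hC : ∀ y : ℝ, 0 < y →
      eLpNorm (fun x : ℝ => F ((x : ℂ) + (y : ℂ) * Complex.I)) p volume ≤ (C : ℝ≥0∞))
    {w : ℂ} (hw : 0 < w.im) {a : ℝ} (ha : 0 ≤ a) (ha1 : a ≤ 1) :
    ‖∫ t : ℝ in (0)..a, F (w + t)‖ ≤ C := by
  have hcont := continuous_horizontal hF hw
  have hcont' : Continuous fun t : ℝ => F ((t : ℂ) + (w.im : ℂ) * Complex.I) := by
    have := continuous_horizontal hF (w := (w.im : ℂ) * Complex.I) (by simpa using hw)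
    simpa [add_comm] using this
  have hfun : (fun t : ℝ => F (w + t)) =
      fun t : ℝ => (fun x : ℝ => F ((x : ℂ) + (w.im : ℂ) * Complex.I)) (w.re + t) := by
    ext t
    simp only
    congr 1
    apply Complex.ext <;> simp
  have h1 : ‖∫ t : ℝ in (0)..a, F (w + t)‖ₑ ≤ C := by
    rw [intervalIntegral.integral_of_le ha]
    calc _ ≤ ∫⁻ t in Set.Ioc 0 a, ‖F (w + t)‖ₑ := enorm_integral_le_lintegral_enorm _
      _ = eLpNorm (fun t : ℝ => F (w + t)) 1 (volume.restrict (Set.Ioc 0 a)) :=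
        eLpNorm_one_eq_lintegral_enorm.symm
      _ ≤ eLpNorm (fun t : ℝ => F (w + t)) p (volume.restrict (Set.Ioc 0 a)) *
          (volume.restrict (Set.Ioc 0 a)) Set.univ ^ (1 / (1 : ℝ≥0∞).toReal - 1 / p.toReal) :=
        eLpNorm_le_eLpNorm_mul_rpow_measure_univ hp1 hcont.aestronglyMeasurable
      _ ≤ eLpNorm (fun t : ℝ => F (w + t)) p volume * 1 := by
        gcongr
        · exact Measure.restrict_le_self
        · refine ENNReal.rpow_le_one ?_ ?_
          · simpa using ha1
          · by_cases hp : p = ∞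
            · simp [hp]
            · have : 1 ≤ p.toReal := by
                rw [← ENNReal.toReal_one]
                exact ENNReal.toReal_mono hp hp1
              have : 1 / p.toReal ≤ 1 := by
                rw [div_le_one (by linarith)]
                exact this
              simpa using this
      _ ≤ C := by
        rw [mul_one, hfun, eLpNorm_comp_add_left hcont'.aestronglyMeasurable]
        exact hC _ hw
  rw [← ofReal_norm] at h1
  have := ENNReal.toReal_mono ENNReal.coe_ne_top h1
  rwa [ENNReal.toReal_ofReal (norm_nonneg _), ENNReal.coe_toReal] at this

/-- A function holomorphic in the upper half-plane with bounded `L^p` norms on horizontal lines is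
bounded at positive distance from the real line. -/
theorem exists_norm_le_of_eLpNorm_le {p : ℝ≥0∞} (hp1 : 1 ≤ p) {F : ℂ → ℂ}
    (hF : DifferentiableOn ℂ F (halfPlane 1)) {C : ℝ≥0}
    (hC : ∀ y : ℝ, 0 < y →
      eLpNorm (fun x : ℝ => F ((x : ℂ) + (y : ℂ) * Complex.I)) p volume ≤ (C : ℝ≥0∞))
    {δ : ℝ} (hδ : 0 < δ) : ∃ B : ℝ, ∀ z : ℂ, δ ≤ z.im → ‖F z‖ ≤ B := by
  -- C bounds the mean of F over the segment from z to z + 1, and C / (δ / 2) bounds the oscillation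
  -- of F along it.
  refine ⟨C + C / (δ / 2), fun z hz => ?_⟩
  have hz0 : 0 < z.im := by linarith
  -- A primitive A of F on a disc in the upper half-plane tangent to the real line below z. M is
  -- taken large enough that the disc contains w + [0, 1] whenever |w - z| ≤ δ/2.
  obtain ⟨M, hM, A, hA⟩ : ∃ M : ℝ, ((2 + δ) ^ 2 + (2 * z.im) ^ 2 < M * δ) ∧
      ∃ A : ℂ → ℂ, ∀ w ∈ Metric.ball ((z.re : ℂ) + M * Complex.I) M, HasDerivAt A (F w) w := by
    refine ⟨((2 + δ) ^ 2 + (2 * z.im) ^ 2) / δ + 1, ?_, ?_⟩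
    · rw [add_mul, div_mul_cancel₀ _ hδ.ne']
      linarith
    · refine DifferentiableOn.isExactOn_ball (hF.mono fun w hw => ?_)
      rw [mem_halfPlane_one]
      rw [Metric.mem_ball, dist_eq_norm] at hw
      generalize ((2 + δ) ^ 2 + (2 * z.im) ^ 2) / δ + 1 = M at hw
      have := (Complex.abs_im_le_norm _).trans_lt hw
      simp at this
      linarith [(abs_lt.1 this).1]
  have hmem : ∀ w : ℂ, ‖w - z‖ ≤ δ / 2 → ∀ t : ℝ, 0 ≤ t → t ≤ 1 →
      w + t ∈ Metric.ball ((z.re : ℂ) + M * Complex.I) M := by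
    intro w hw t ht0 ht1
    have h1 := (Complex.abs_re_le_norm _).trans hw
    have h2 := (Complex.abs_im_le_norm _).trans hw
    rw [Complex.sub_re, abs_le] at h1
    rw [Complex.sub_im, abs_le] at h2
    have hM0 : 0 < M := by
      by_contra h
      nlinarith [sq_nonneg (2 + δ), sq_nonneg (2 * z.im)]
    rw [Metric.mem_ball, dist_eq_norm, ← sq_lt_sq₀ (norm_nonneg _) hM0.le,
      ← Complex.normSq_eq_norm_sq, Complex.normSq_apply]
    simp
    have e1 : (w.re + t - z.re) ^ 2 ≤ (2 + δ) ^ 2 := by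
      apply sq_le_sq'
      · linarith
      · linarith
    have e2 : w.im ^ 2 ≤ (2 * z.im) ^ 2 := by
      apply sq_le_sq'
      · linarith
      · linarith
    have e3 : M * δ ≤ M * (2 * w.im) := by
      gcongr
      linarith
    nlinarith
  have him : ∀ w : ℂ, ‖w - z‖ ≤ δ / 2 → 0 < w.im := by
    intro w hw
    have h2 := (Complex.abs_im_le_norm _).trans hw
    rw [Complex.sub_im, abs_le] at h2
    linarith
  have hFTC : ∀ a : ℝ, 0 ≤ a → a ≤ 1 → ∀ w : ℂ, ‖w - z‖ ≤ δ / 2 →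
      A (w + a) - A w = ∫ t : ℝ in (0)..a, F (w + t) := by
    intro a ha0 ha1 w hw
    have := intervalIntegral.integral_eq_sub_of_hasDerivAt (a := 0) (b := a)
      (f := fun t : ℝ => A (w + t)) (f' := fun t : ℝ => F (w + t)) (fun t ht => by
        rw [Set.uIcc_of_le ha0] at ht
        have h := hA _ (hmem w hw t ht.1 (ht.2.trans ha1))
        have h2 : HasDerivAt (fun t : ℝ => w + (t : ℂ)) 1 t :=
          Complex.ofRealCLM.hasDerivAt.const_add w
        simpa using! h.scomp t h2)
      ((continuous_horizontal hF (him w hw)).intervalIntegrable _ _)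
    simpa using this.symm
  have hzz : ‖z - z‖ ≤ δ / 2 := by simp; linarith
  -- The increment A(w + a) - A(w) is an integral of F over a short segment, hence bounded by C;
  -- Cauchy's estimate on the circle of radius δ/2 bounds its derivative F(z + a) - F(z).
  have hdiff : ∀ a : ℝ, 0 ≤ a → a ≤ 1 → ‖F (z + a) - F z‖ ≤ C / (δ / 2) := by
    intro a ha0 ha1
    have hder : ∀ w : ℂ, ‖w - z‖ ≤ δ / 2 →
        HasDerivAt (fun w => A (w + a) - A w) (F (w + a) - F w) w := by
      intro w hw
      have h0 := hA w (by simpa using hmem w hw 0 le_rfl zero_le_one)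
      exact ((hA _ (hmem w hw a ha0 ha1)).comp_add_const w (a : ℂ)).sub h0
    have hdc : DiffContOnCl ℂ (fun w => A (w + a) - A w) (Metric.ball z (δ / 2)) := by
      refine DifferentiableOn.diffContOnCl ?_
      rw [closure_ball _ (by linarith)]
      intro w hw
      rw [Metric.mem_closedBall, dist_eq_norm] at hw
      exact (hder w hw).differentiableAt.differentiableWithinAt
    have := Complex.norm_deriv_le_of_forall_mem_sphere_norm_le (by linarith) hdc (C := C)
      (fun w hw => by
        rw [Metric.mem_sphere, dist_eq_norm] at hw
        rw [hFTC a ha0 ha1 w hw.le]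
        exact norm_intervalIntegral_horizontal_le hp1 hF hC (him w hw.le) ha0 ha1)
    rwa [(hder z hzz).deriv] at this
  have hcont := continuous_horizontal hF hz0
  have hsplit : F z = (∫ t : ℝ in (0)..1, F (z + t)) - ∫ t : ℝ in (0)..1, (F (z + t) - F z) := by
    rw [intervalIntegral.integral_sub (hcont.intervalIntegrable _ _) (by simp)]
    simp
  rw [hsplit]
  refine (norm_sub_le _ _).trans (add_le_add ?_ ?_)
  · exact norm_intervalIntegral_horizontal_le hp1 hF hC hz0 zero_le_one le_rfl
  · have := intervalIntegral.norm_integral_le_of_norm_le_const (a := 0) (b := 1)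
      (f := fun t : ℝ => F (z + t) - F z) (C := C / (δ / 2)) (fun t ht => by
        rw [Set.uIoc_of_le zero_le_one] at ht
        exact hdiff t ht.1.le ht.2)
    simpa using this

/-- For exponents greater than one, `L^p`-boundedness and almost everywhere convergence imply
convergence of integrals against a finite measure with bounded density. -/
theorem tendsto_integral_of_eLpNorm_le {p : ℝ≥0∞} (hp1 : 1 < p) (hp : p ≠ ∞) {ν : Measure ℝ}
    [IsFiniteMeasure ν] {c : ℝ≥0∞} (hc : c ≠ ∞) (hν : ν ≤ c • volume) {g : ℕ → ℝ → ℂ}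
    {f : ℝ → ℂ} {C : ℝ≥0} (hg : ∀ n, AEStronglyMeasurable (g n) volume)
    (hgC : ∀ n, eLpNorm (g n) p volume ≤ C) (hf : MemLp f p volume)
    (hlim : ∀ᵐ x, Tendsto (fun n => g n x) atTop (𝓝 (f x))) :
    Tendsto (fun n => ∫ x, g n x ∂ν) atTop (𝓝 (∫ x, f x ∂ν)) := by
  have hac : ν ≪ volume :=
    (Measure.absolutelyContinuous_of_le hν).trans Measure.smul_absolutelyContinuous
  have hgν : ∀ n, AEStronglyMeasurable (g n) ν := fun n => (hg n).mono_ac hac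
  have hbd : ∀ h : ℝ → ℂ, eLpNorm h p ν ≤ c ^ (1 / p.toReal) * eLpNorm h p volume := by
    intro h
    refine (eLpNorm_mono_measure h hν).trans ?_
    rw [eLpNorm_smul_measure_of_ne_top hp, smul_eq_mul, one_div, ENNReal.toReal_inv, one_div]
  have hp1' : 1 < p.toReal := by
    rw [← ENNReal.toReal_one]
    exact (ENNReal.toReal_lt_toReal ENNReal.one_ne_top hp).2 hp1
  have hcK : c ^ (1 / p.toReal) ≠ ∞ := ENNReal.rpow_ne_top_of_nonneg (by positivity) hc
  have hfν : MemLp f p ν :=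
    ⟨hf.1.mono_ac hac, (hbd f).trans_lt (ENNReal.mul_lt_top hcK.lt_top hf.2)⟩
  obtain ⟨K, hK⟩ : ∃ K : ℝ≥0, (K : ℝ≥0∞) = c ^ (1 / p.toReal) * C :=
    ⟨_, ENNReal.coe_toNNReal (ENNReal.mul_ne_top hcK ENNReal.coe_ne_top)⟩
  have hgK : ∀ n, eLpNorm (g n) p ν ≤ K := fun n => by
    rw [hK]
    exact (hbd _).trans (by gcongr; exact hgC n)
  set a : ℝ := 1 - 1 / p.toReal with ha
  have ha0 : 0 < a := by
    have : 1 / p.toReal < 1 := by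
      rw [div_lt_one (by linarith)]
      exact hp1'
    linarith
  have hui : UnifIntegrable g 1 ν := by
    intro ε hε
    have hb : 0 < ε / (K + 1) := by positivity
    -- Hölder bounds the L¹ norm on s by K ν(s)^a, where a > 0 because p > 1. Using K + 1 avoids
    -- dividing by zero.
    refine ⟨(ε / (K + 1)) ^ (1 / a), by positivity, fun n s hs hνs => ?_⟩
    rw [eLpNorm_indicator_eq_eLpNorm_restrict hs]
    calc _ ≤ eLpNorm (g n) p (ν.restrict s) *
          (ν.restrict s) Set.univ ^ (1 / (1 : ℝ≥0∞).toReal - 1 / p.toReal) :=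
        eLpNorm_le_eLpNorm_mul_rpow_measure_univ hp1.le (hgν n).restrict
      _ ≤ K * (ENNReal.ofReal ((ε / (K + 1)) ^ (1 / a))) ^ a := by
        rw [ENNReal.toReal_one, div_one, ← ha, Measure.restrict_apply_univ]
        gcongr
        exact (eLpNorm_mono_measure _ Measure.restrict_le_self).trans (hgK n)
      _ = ENNReal.ofReal (K * (ε / (K + 1))) := by
        rw [ENNReal.ofReal_rpow_of_pos (by positivity), ← Real.rpow_mul hb.le,
          one_div_mul_cancel ha0.ne', Real.rpow_one, ENNReal.ofReal_mul (NNReal.coe_nonneg K),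
          ENNReal.ofReal_coe_nnreal]
      _ ≤ ENNReal.ofReal ε := by
        apply ENNReal.ofReal_le_ofReal
        rw [mul_div_assoc', div_le_iff₀ (by positivity)]
        nlinarith
  refine tendsto_integral_of_L1' f hfν.1 (Eventually.of_forall fun n => ?_) ?_
  · have : MemLp (g n) p ν := ⟨hgν n, (hgK n).trans_lt ENNReal.coe_lt_top⟩
    exact this.integrable hp1.le
  · exact tendsto_Lp_finite_of_tendsto_ae le_rfl ENNReal.one_ne_top hgν
      (hfν.mono_exponent hp1.le) hui (hac.ae_le hlim)

/-- The image measure is the Poisson measure of x + iy; its density is at most 1/(πy), as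
`tendsto_integral_of_eLpNorm_le` requires. -/
theorem map_cauchyMeasure_le (x : ℝ) {y : ℝ} (hy : 0 < y) :
    (ProbabilityTheory.cauchyMeasure 0 1).map (fun t => x + y * t) ≤
      (ENNReal.ofReal Real.pi⁻¹ * ENNReal.ofReal |y⁻¹|) • volume := by
  have h1 : ProbabilityTheory.cauchyMeasure 0 1 ≤ ENNReal.ofReal Real.pi⁻¹ • volume := by
    rw [ProbabilityTheory.cauchyMeasure_of_scale_ne_zero 0 one_ne_zero, ← withDensity_const]
    refine withDensity_mono (ae_of_all _ fun t => ?_)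
    rw [ProbabilityTheory.cauchyPDF_def, ProbabilityTheory.cauchyPDFReal_def']
    apply ENNReal.ofReal_le_ofReal
    have : (1 + t ^ 2)⁻¹ ≤ 1 := inv_le_one_of_one_le₀ (by nlinarith [sq_nonneg t])
    simpa using mul_le_mul_of_nonneg_left this (inv_nonneg.2 Real.pi_pos.le)
  have hm : Measurable fun t : ℝ => x + y * t := by fun_prop
  refine (Measure.map_mono h1 hm).trans (le_of_eq ?_)
  rw [Measure.map_smul]
  have h2 : (volume : Measure ℝ).map (fun t => x + y * t) = ENNReal.ofReal |y⁻¹| • volume := by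
    have : (fun t : ℝ => x + y * t) = (fun t => x + t) ∘ (fun t => y * t) := rfl
    rw [this, ← Measure.map_map (by fun_prop) (by fun_prop), Real.map_volume_mul_left hy.ne',
      Measure.map_smul, (measurePreserving_add_left volume x).map_eq]
  rw [h2, smul_smul]

theorem tendsto_vertical_approachRegion (x : ℝ) {ε : ℕ → ℝ} (hε : ∀ n, 0 < ε n)
    (hε0 : Tendsto ε atTop (𝓝 0)) :
    Tendsto (fun n => (x : ℂ) + (ε n : ℂ) * Complex.I) atTop
      (𝓝[approachRegion 1 1 x] (x : ℂ)) := by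
  refine tendsto_nhdsWithin_iff.2 ⟨?_, Eventually.of_forall fun n => ?_⟩
  · have : Continuous fun e : ℝ => (x : ℂ) + (e : ℂ) * Complex.I := by fun_prop
    have h := (this.tendsto 0).comp hε0
    simpa [Function.comp_def] using h
  · simp [approachRegion, hε n]

/-- The Poisson representation of a Hardy function on the upper half-plane. -/
theorem IsHardyWithBoundary.eq_integral {p : ℝ≥0∞} (hp1 : 1 < p) (hp : p ≠ ∞) {F : ℂ → ℂ}
    {f : ℝ → ℂ} (h : IsHardyWithBoundary 1 p F f) (hf : MemLp f p volume) (x : ℝ) {y : ℝ}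
    (hy : 0 < y) :
    F ((x : ℂ) + (y : ℂ) * Complex.I) =
      ∫ t, f (x + y * t) ∂(ProbabilityTheory.cauchyMeasure 0 1) := by
  obtain ⟨C, hC⟩ := h.bounded
  simp only [one_mul] at hC
  set ε : ℕ → ℝ := fun n => 1 / ((n : ℝ) + 1) with hε
  have hεpos : ∀ n, 0 < ε n := fun n => Nat.one_div_pos_of_nat
  have hε0 : Tendsto ε atTop (𝓝 0) := tendsto_one_div_add_atTop_nhds_zero_nat
  -- The Poisson formula at i for z ↦ F(x + yz + iε): its arguments stay at height at least ε, where
  -- F is bounded.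
  have hstep : ∀ n, F ((x : ℂ) + y * Complex.I + ε n * Complex.I) =
      ∫ t : ℝ, F ((x : ℂ) + y * t + ε n * Complex.I) ∂(ProbabilityTheory.cauchyMeasure 0 1) := by
    intro n
    obtain ⟨B, hB⟩ := exists_norm_le_of_eLpNorm_le hp1.le h.holomorphic hC (hεpos n)
    have hmaps : ∀ z : ℂ, 0 ≤ z.im → ε n ≤ ((x : ℂ) + y * z + ε n * Complex.I).im := by
      intro z hz
      simp
      positivity
    have hd : DifferentiableOn ℂ (fun z : ℂ => F ((x : ℂ) + y * z + ε n * Complex.I))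
        {z | 0 ≤ z.im} := by
      refine h.holomorphic.comp (by fun_prop) fun z hz => ?_
      rw [mem_halfPlane_one]
      exact (hεpos n).trans_le (hmaps z hz)
    exact (integral_cauchyMeasure_eq (H := fun z : ℂ => F ((x : ℂ) + y * z + ε n * Complex.I))
      hd.continuousOn (hd.mono fun z (hz : 0 < z.im) => hz.le) fun z hz => hB _ (hmaps z hz)).symm
  have hm : Measurable fun t : ℝ => x + y * t := by fun_prop
  set ν := (ProbabilityTheory.cauchyMeasure 0 1).map (fun t => x + y * t) with hνdef
  have hνle := map_cauchyMeasure_le x hy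
  rw [← hνdef] at hνle
  have : IsProbabilityMeasure ν := Measure.isProbabilityMeasure_map hm.aemeasurable
  have hac : ν ≪ volume :=
    (Measure.absolutelyContinuous_of_le hνle).trans Measure.smul_absolutelyContinuous
  have hmeas : ∀ n, AEStronglyMeasurable (fun u : ℝ => F ((u : ℂ) + (ε n : ℂ) * Complex.I))
      (volume : Measure ℝ) := fun n => h.aestronglyMeasurable (by simpa using hεpos n)
  have hlim := tendsto_integral_of_eLpNorm_le hp1 hp
    (ENNReal.mul_ne_top ENNReal.ofReal_ne_top ENNReal.ofReal_ne_top) hνle hmeas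
    (fun n => hC _ (hεpos n)) hf (by
      filter_upwards [h.boundary] with u hu
      exact (hu 1 one_pos).comp (tendsto_vertical_approachRegion u hεpos hε0))
  rw [integral_map hm.aemeasurable (hf.1.mono_ac hac)] at hlim
  refine tendsto_nhds_unique ?_ hlim
  have heq : (fun n => ∫ u : ℝ, F ((u : ℂ) + (ε n : ℂ) * Complex.I) ∂ν) =
      fun n => F ((x : ℂ) + y * Complex.I + ε n * Complex.I) := by
    ext n
    rw [integral_map hm.aemeasurable ((hmeas n).mono_ac hac), hstep]
    simp
  rw [heq]
  have hmem : (x : ℂ) + y * Complex.I ∈ halfPlane 1 := by simpa [mem_halfPlane_one] using hy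
  have hcont : ContinuousAt F ((x : ℂ) + y * Complex.I) :=
    h.holomorphic.continuousOn.continuousAt ((isOpen_halfPlane 1).mem_nhds hmem)
  refine hcont.tendsto.comp ?_
  have : Continuous fun e : ℝ => (x : ℂ) + y * Complex.I + (e : ℂ) * Complex.I := by fun_prop
  simpa [Function.comp_def] using (this.tendsto 0).comp hε0

/-- The `L^p` norm of a Hardy function on a horizontal line is at most that of its boundary
function. -/
theorem IsHardyWithBoundary.eLpNorm_le {p : ℝ≥0∞} (hp1 : 1 < p) (hp : p ≠ ∞) {F : ℂ → ℂ}
    {f : ℝ → ℂ} (h : IsHardyWithBoundary 1 p F f) (hf : MemLp f p volume) {y : ℝ}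
    (hy : 0 < y) :
    eLpNorm (fun x : ℝ => F ((x : ℂ) + (y : ℂ) * Complex.I)) p volume ≤ eLpNorm f p volume := by
  -- A strongly measurable representative makes (x, t) ↦ f'(x + yt) measurable for Tonelli;
  -- translation invariance then removes t from the inner integral.
  obtain ⟨f', hf'm, hff'⟩ := hf.1
  have hf' : MemLp f' p volume := hf.ae_eq hff'
  have h' : IsHardyWithBoundary 1 p F f' := by
    refine ⟨h.holomorphic, h.bounded, ?_⟩
    filter_upwards [h.boundary, hff'] with x hx hxx
    rwa [← hxx]
  rw [eLpNorm_congr_ae hff']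
  lift p to ℝ≥0 using hp
  have hp0 : p ≠ 0 := by
    rintro rfl
    simp at hp1
  have hpR : 0 < (p : ℝ) := NNReal.coe_pos.2 (pos_iff_ne_zero.2 hp0)
  rw [← ENNReal.rpow_le_rpow_iff hpR, eLpNorm_nnreal_pow_eq_lintegral hp0,
    eLpNorm_nnreal_pow_eq_lintegral hp0]
  -- Jensen's inequality for the Cauchy probability measure, as monotonicity of `eLpNorm` in the
  -- exponent.
  have hpt : ∀ x : ℝ, ‖F ((x : ℂ) + (y : ℂ) * Complex.I)‖ₑ ^ (p : ℝ) ≤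
      ∫⁻ t, ‖f' (x + y * t)‖ₑ ^ (p : ℝ) ∂(ProbabilityTheory.cauchyMeasure 0 1) := by
    intro x
    rw [h'.eq_integral hp1 ENNReal.coe_ne_top hf' x hy, ← eLpNorm_nnreal_pow_eq_lintegral hp0]
    gcongr
    refine (enorm_integral_le_lintegral_enorm _).trans ?_
    rw [← eLpNorm_one_eq_lintegral_enorm]
    refine eLpNorm_le_eLpNorm_of_exponent_le hp1.le ?_
    exact (hf'm.comp_measurable (by fun_prop)).aestronglyMeasurable
  calc _ ≤ ∫⁻ x : ℝ, ∫⁻ t, ‖f' (x + y * t)‖ₑ ^ (p : ℝ)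
        ∂(ProbabilityTheory.cauchyMeasure 0 1) := lintegral_mono hpt
    _ = ∫⁻ t, (∫⁻ x : ℝ, ‖f' (x + y * t)‖ₑ ^ (p : ℝ))
        ∂(ProbabilityTheory.cauchyMeasure 0 1) := by
      refine lintegral_lintegral_swap (Measurable.aemeasurable ?_)
      have : Measurable fun q : ℝ × ℝ => f' (q.1 + y * q.2) :=
        hf'm.measurable.comp (by fun_prop)
      exact this.enorm.pow_const _
    _ = ∫⁻ _, (∫⁻ x : ℝ, ‖f' x‖ₑ ^ (p : ℝ)) ∂(ProbabilityTheory.cauchyMeasure 0 1) := by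
      congr 1
      ext t
      exact lintegral_add_right_eq_self (fun x => ‖f' x‖ₑ ^ (p : ℝ)) (y * t)
    _ ≤ _ := by simp

/-! ### Transfer to the lower half-plane. -/

theorem eLpNorm_comp_neg {p : ℝ≥0∞} {h : ℝ → ℂ} (hh : AEStronglyMeasurable h volume) :
    eLpNorm (fun x => h (-x)) p volume = eLpNorm h p volume :=
  eLpNorm_comp_measurePreserving hh (Measure.measurePreserving_neg volume)

/-- The map z ↦ -z is holomorphic, preserves Lebesgue measure on the line, and exchanges the
half-planes together with their cones. -/
theorem IsHardyWithBoundary.comp_neg {s : ℝ} {p : ℝ≥0∞} {F : ℂ → ℂ} {f : ℝ → ℂ}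
    (h : IsHardyWithBoundary s p F f) :
    IsHardyWithBoundary (-s) p (fun z => F (-z)) (fun x => f (-x)) := by
  refine ⟨?_, ?_, ?_⟩
  · refine h.holomorphic.comp (by fun_prop) fun z hz => ?_
    simpa [halfPlane] using hz
  · obtain ⟨C, hC⟩ := h.bounded
    refine ⟨C, fun y hy => ?_⟩
    have hy' : 0 < s * -y := by linarith
    have heq : (fun x : ℝ => F (-((x : ℂ) + y * Complex.I))) =
        fun x : ℝ => (fun x : ℝ => F ((x : ℂ) + ((-y : ℝ) : ℂ) * Complex.I)) (-x) := by
      ext x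
      simp only
      congr 1
      push_cast
      ring
    rw [heq, eLpNorm_comp_neg (h.aestronglyMeasurable hy')]
    exact hC _ hy'
  · have h1 := (Measure.measurePreserving_neg (volume : Measure ℝ)).quasiMeasurePreserving.ae
      h.boundary
    filter_upwards [h1] with x hx a ha
    refine (hx a ha).comp (tendsto_nhdsWithin_iff.2 ⟨?_, ?_⟩)
    · have : Continuous fun z : ℂ => -z := continuous_neg
      simpa using (this.tendsto (x : ℂ)).mono_left nhdsWithin_le_nhds
    · filter_upwards [self_mem_nhdsWithin] with z hz
      refine ⟨by simpa using hz.1, ?_⟩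
      have h2 := hz.2
      rw [← abs_neg] at h2
      have e1 : (-z).re - -x = -(z.re - x) := by simp; ring
      have e2 : s * (-z).im = -s * z.im := by simp
      rw [e1, e2]
      exact h2

theorem IsHardyWithBoundary.eLpNorm_le_lower {p : ℝ≥0∞} (hp1 : 1 < p) (hp : p ≠ ∞)
    {F : ℂ → ℂ} {f : ℝ → ℂ} (h : IsHardyWithBoundary (-1) p F f) (hf : MemLp f p volume)
    {y : ℝ} (hy : y < 0) :
    eLpNorm (fun x : ℝ => F ((x : ℂ) + (y : ℂ) * Complex.I)) p volume ≤ eLpNorm f p volume := by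
  have h' := h.comp_neg
  rw [neg_neg] at h'
  have hf' : MemLp (fun x => f (-x)) p volume :=
    hf.comp_measurePreserving (Measure.measurePreserving_neg volume)
  have := h'.eLpNorm_le hp1 hp hf' (neg_pos.2 hy)
  rw [eLpNorm_comp_neg hf.1] at this
  refine (le_of_eq ?_).trans this
  rw [← eLpNorm_comp_neg (h.aestronglyMeasurable (by linarith))]
  congr 1
  ext x
  congr 1
  push_cast
  ring

/-! ### Multipliers of Hardy functions. -/

/-- Multiplication by a bounded holomorphic function preserves the Hardy space. -/
theorem IsHardyWithBoundary.bdd_mul {s : ℝ} {p : ℝ≥0∞} {F M : ℂ → ℂ} {f : ℝ → ℂ}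
    (h : IsHardyWithBoundary s p F f) {B : ℝ} (hM : DifferentiableOn ℂ M (halfPlane s))
    (hB : ∀ z ∈ halfPlane s, ‖M z‖ ≤ B) (hMc : ∀ᵐ x : ℝ, ContinuousAt M (x : ℂ)) :
    IsHardyWithBoundary s p (fun z => M z * F z) (fun x => M x * f x) := by
  refine ⟨hM.mul h.holomorphic, ?_, ?_⟩
  · obtain ⟨C, hC⟩ := h.bounded
    refine ⟨B.toNNReal * C, fun y hy => ?_⟩
    refine (eLpNorm_le_mul_eLpNorm_of_ae_le_mul (c := B)
      (g := fun x : ℝ => F ((x : ℂ) + (y : ℂ) * Complex.I)) (ae_of_all _ fun x => ?_) p).trans ?_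
    · rw [norm_mul]
      gcongr
      exact hB _ (by simpa [halfPlane] using hy)
    · rw [ENNReal.coe_mul]
      gcongr
      · exact le_rfl
      · exact hC y hy
  · filter_upwards [h.boundary, hMc] with x hx hxM a ha
    exact (hxM.tendsto.mono_left nhdsWithin_le_nhds).mul (hx a ha)

theorem ae_ne_const (c : ℝ) : ∀ᵐ x : ℝ, x ≠ c := by
  simp [ae_iff]

/-- Division by the branch `((z + s i)/(z - c))^α` preserves the Hardy space. -/
theorem IsHardyWithBoundary.inv_branchPow_mul {s : ℝ} (hs : s ^ 2 = 1) {p : ℝ≥0∞} {F : ℂ → ℂ}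
    {f : ℝ → ℂ} (h : IsHardyWithBoundary s p F f) (c : ℝ) {α : ℝ} (hα : 0 ≤ α) :
    IsHardyWithBoundary s p (fun z => (branchPow s c α z)⁻¹ * F z)
      (fun x => (branchPow s c α x)⁻¹ * f x) := by
  refine h.bdd_mul (M := fun z => (branchPow s c α z)⁻¹) (fun z hz => ?_)
    (fun z hz => norm_inv_branchPow_le hs hα (le_of_lt hz)) ?_
  · have hzc := ne_ofReal_of_mem_halfPlane hz c
    exact ((differentiableAt_branchPow α hs (le_of_lt hz) hzc).inv
      (branchPow_ne_zero α hs (le_of_lt hz) hzc)).differentiableWithinAt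
  · filter_upwards [ae_ne_const c] with x hx
    have hxc : (x : ℂ) ≠ c := by exact_mod_cast hx
    exact (differentiableAt_branchPow α hs (by simp) hxc).continuousAt.inv₀
      (branchPow_ne_zero α hs (by simp) hxc)

/-- If `F` is a Hardy function on the lower half-plane and its product with the unbounded branch
`((z - i)/(z - c))^α` has boundary values in `L^p`, then this product is a Hardy function. -/
theorem IsHardyWithBoundary.branchPow_mul {p : ℝ≥0∞} (hp1 : 1 < p) (hp : p ≠ ∞) {F : ℂ → ℂ}
    {f : ℝ → ℂ} (h : IsHardyWithBoundary (-1) p F f) (hf : MemLp f p volume) {c α : ℝ}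
    (hα : 0 ≤ α) (hmf : MemLp (fun x : ℝ => branchPow (-1) c α x * f x) p volume) :
    IsHardyWithBoundary (-1) p (fun z => branchPow (-1) c α z * F z)
      (fun x => branchPow (-1) c α x * f x) := by
  have hs : (-1 : ℝ) ^ 2 = 1 := by norm_num
  have hd : ∀ z ∈ halfPlane (-1), DifferentiableAt ℂ (branchPow (-1) c α) z := fun z hz =>
    differentiableAt_branchPow α hs (le_of_lt hz) (ne_ofReal_of_mem_halfPlane hz c)
  have hhol : DifferentiableOn ℂ (fun z => branchPow (-1) c α z * F z) (halfPlane (-1)) :=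
    DifferentiableOn.mul (fun z hz => (hd z hz).differentiableWithinAt) h.holomorphic
  refine ⟨hhol, ?_, ?_⟩
  · obtain ⟨D, hD⟩ : ∃ D : ℝ≥0, (D : ℝ≥0∞) = ENNReal.ofReal (2 ^ α) *
        eLpNorm (fun x : ℝ => branchPow (-1) c α x * f x) p volume :=
      ⟨_, ENNReal.coe_toNNReal (ENNReal.mul_ne_top ENNReal.ofReal_ne_top hmf.2.ne)⟩
    refine ⟨D, fun y hy => ?_⟩
    have hy0 : y < 0 := by linarith
    set ε : ℕ → ℝ := fun n => 1 / ((n : ℝ) + 1) with hε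
    have hεpos : ∀ n, 0 < ε n := fun n => Nat.one_div_pos_of_nat
    have hε1 : ∀ n, ε n ≤ 1 := fun n => by
      rw [hε]
      simp only
      rw [div_le_one (by positivity)]
      linarith [n.cast_nonneg (α := ℝ)]
    have hε0 : Tendsto ε atTop (𝓝 0) := tendsto_one_div_add_atTop_nhds_zero_nat
    -- The shift moves the singularity to c + iε, at distance ε from the closed lower half-plane, so
    -- each M n is bounded there and continuous on the line.
    set M : ℕ → ℂ → ℂ :=
      fun n z => branchPow (-1) c α (z + ((-1 * ε n : ℝ) : ℂ) * Complex.I) with hM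
    have him : ∀ n (z : ℂ), (z + ((-1 * ε n : ℝ) : ℂ) * Complex.I).im = z.im - ε n := by
      intro n z
      simp [sub_eq_add_neg]
    have hMd : ∀ n (z : ℂ), z.im ≤ 0 → DifferentiableAt ℂ (M n) z := by
      intro n z hz
      refine DifferentiableAt.comp z (hd _ ?_) (by fun_prop)
      change 0 < -1 * Complex.im _
      rw [him]
      linarith [hεpos n]
    have hhalf : ∀ z ∈ halfPlane (-1), z.im ≤ 0 := fun z hz => by
      have : 0 < -1 * z.im := hz
      linarith
    have hMhardy : ∀ n, IsHardyWithBoundary (-1) p (fun z => M n z * F z)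
        (fun x => M n x * f x) := by
      intro n
      refine h.bdd_mul (fun z hz => (hMd n z (hhalf z hz)).differentiableWithinAt)
        (fun z hz => norm_branchPow_le hα (hεpos n) ?_)
        (ae_of_all _ fun x => (hMd n x (by simp)).continuousAt)
      have h1 := Complex.abs_im_le_norm (z + ((-1 * ε n : ℝ) : ℂ) * Complex.I - c)
      rw [Complex.sub_im, him, Complex.ofReal_im, sub_zero] at h1
      refine le_trans ?_ h1
      rw [le_abs]
      right
      linarith [hhalf z hz]
    have hMf : ∀ n, ∀ᵐ x : ℝ,
        ‖M n x * f x‖ ≤ 2 ^ α * ‖branchPow (-1) c α x * f x‖ := by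
      intro n
      filter_upwards [ae_ne_const c] with x hx
      rw [norm_mul, norm_mul, ← mul_assoc]
      gcongr
      exact norm_branchPow_shift_le hs hα (hεpos n).le (hε1 n) hx
    have hMfm : ∀ n, MemLp (fun x : ℝ => M n x * f x) p volume := fun n =>
      hmf.of_le_mul (((measurable_branchPow (-1) c α).comp
        (by fun_prop)).aestronglyMeasurable.mul hf.1) (hMf n)
    -- The bound passes from the boundary to the line at height y, uniformly in n and y.
    have hn : ∀ n, eLpNorm (fun x : ℝ => M n ((x : ℂ) + (y : ℂ) * Complex.I) *
        F ((x : ℂ) + (y : ℂ) * Complex.I)) p volume ≤ D := by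
      intro n
      refine ((hMhardy n).eLpNorm_le_lower hp1 hp (hMfm n) hy0).trans ?_
      rw [hD]
      exact eLpNorm_le_mul_eLpNorm_of_ae_le_mul (hMf n) p
    -- Fatou's lemma as ε tends to 0.
    refine (Lp.eLpNorm_lim_le_liminf_eLpNorm (f := fun n (x : ℝ) =>
      M n ((x : ℂ) + (y : ℂ) * Complex.I) * F ((x : ℂ) + (y : ℂ) * Complex.I))
      (fun n => (hMhardy n).aestronglyMeasurable hy) _ (ae_of_all _ fun x => ?_)).trans ?_
    · refine Tendsto.mul_const _ ?_
      have hz : (x : ℂ) + (y : ℂ) * Complex.I ∈ halfPlane (-1) := by simpa [halfPlane] using hy0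
      refine (hd _ hz).continuousAt.tendsto.comp ?_
      have : Continuous fun e : ℝ => (x : ℂ) + y * Complex.I + ((-1 * e : ℝ) : ℂ) * Complex.I := by
        fun_prop
      simpa [Function.comp_def] using (this.tendsto 0).comp hε0
    · exact liminf_le_of_frequently_le' (Frequently.of_forall hn)
  · filter_upwards [h.boundary, ae_ne_const c] with x hx hxc a ha
    have hxc' : (x : ℂ) ≠ c := by exact_mod_cast hxc
    exact ((differentiableAt_branchPow α hs (by simp) hxc').continuousAt.tendsto.mono_left
      nhdsWithin_le_nhds).mul (hx a ha)

/-! ### Toeplitz kernels and the theorem. -/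

theorem IsHardyWithBoundary.congr_ae {s : ℝ} {p : ℝ≥0∞} {F : ℂ → ℂ} {f g : ℝ → ℂ}
    (h : IsHardyWithBoundary s p F f) (hfg : f =ᵐ[volume] g) : IsHardyWithBoundary s p F g := by
  refine ⟨h.holomorphic, h.bounded, ?_⟩
  filter_upwards [h.boundary, hfg] with x hx hxx
  rwa [← hxx]

/-- For P⁺(gφ) = 0, `IsRieszProj` asks only that gφ lie in H⁻, so boundedness of P⁺ plays no role.
-/
theorem mem_toeplitzKer_iff {p : ℝ≥0∞} {g : ℝ → ℂ} {φ : Lp ℂ p (volume : Measure ℝ)} :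
    φ ∈ toeplitzKer p g ↔ φ ∈ toeplitzDomain p g ∧
      ∃ F : ℂ → ℂ, IsHardyWithBoundary (-1) p F (fun ξ => g ξ * φ ξ) := by
  constructor
  · rintro ⟨h, -, h2⟩
    rw [sub_zero] at h2
    obtain ⟨F, hF⟩ := h2
    exact ⟨h, F, hF.congr_ae h.2.coeFn_toLp⟩
  · rintro ⟨h, F, hF⟩
    refine ⟨h, Submodule.zero_mem _, ?_⟩
    rw [sub_zero]
    exact ⟨F, hF.congr_ae h.2.coeFn_toLp.symm⟩

theorem toeplitzDomain_eq {p : ℝ≥0∞} {f g : ℝ → ℂ} (hfm : AEMeasurable f volume) (c α : ℝ)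
    (hg : g =ᵐ[volume] fun ξ : ℝ => f ξ * rPow c (α : ℂ) ξ) :
    toeplitzDomain p g = toeplitzDomain p f := by
  have hgm : AEMeasurable g volume :=
    (hfm.mul (measurable_rPow c α).aemeasurable).congr hg.symm
  ext φ
  refine and_congr_right fun _ => memLp_congr_norm
    (hgm.aestronglyMeasurable.mul (Lp.aestronglyMeasurable φ))
    (hfm.aestronglyMeasurable.mul (Lp.aestronglyMeasurable φ)) ?_
  filter_upwards [hg, ae_ne_const c] with ξ h1 h2
  rw [h1, norm_mul, norm_mul, norm_mul, norm_rPow α h2, mul_one]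

end HardyToeplitz

end

theorem theorem8p1 (p : ℝ≥0∞) (hp1 : 1 < p) (hp : p ≠ ∞)
    (f : ℝ → ℂ) (hf : f ∈ HardyToeplitz.symbolClass p)
    (c α : ℝ) (hα0 : 0 < α) (hα1 : α < 1)
    (g : ℝ → ℂ)
    (hg : g =ᵐ[volume] fun ξ : ℝ => f ξ * HardyToeplitz.rPow c (α : ℂ) ξ) :
    HardyToeplitz.toeplitzDomain p g = HardyToeplitz.toeplitzDomain p f ∧
    HardyToeplitz.toeplitzKer p g =
      HardyToeplitz.mulSet (HardyToeplitz.factorPow c (α : ℂ)) (HardyToeplitz.toeplitzKer p f) ∩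
        HardyToeplitz.toeplitzDomain p g := by
  open HardyToeplitz in
  have hdom := toeplitzDomain_eq (p := p) hf.1 c α hg
  refine ⟨hdom, Set.ext fun φ => ⟨fun hφ => ?_, fun hφ => ?_⟩⟩
  · obtain ⟨hφg, G, hG⟩ := mem_toeplitzKer_iff.1 hφ
    obtain ⟨Φ, hΦ⟩ := hφg.1
    have hs1 : (1 : ℝ) ^ 2 = 1 := by norm_num
    have hs2 : (-1 : ℝ) ^ 2 = 1 := by norm_num
    -- The witness is k = φ/b₊, in H⁺ because 1/b₊ is bounded.
    have hk0 := hΦ.inv_branchPow_mul hs1 c hα0.le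
    have hkm : MemLp (fun ξ : ℝ => (branchPow 1 c α ξ)⁻¹ * φ ξ) p volume :=
      (Lp.memLp φ).of_le_mul
        ((((measurable_branchPow 1 c α).comp Complex.measurable_ofReal).inv
          ).aestronglyMeasurable.mul (Lp.aestronglyMeasurable φ))
        (ae_of_all _ fun ξ => by
          rw [norm_mul]
          gcongr
          exact norm_inv_branchPow_le hs1 hα0.le (by simp))
    have hkφ := hkm.coeFn_toLp
    -- Since g = f b₋/b₊, the product fk is gφ/b₋, which lies in H⁻.
    have hfk0 := hG.inv_branchPow_mul hs2 c hα0.le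
    have hgk0 : MemLp (fun ξ : ℝ => (branchPow (-1) c α ξ)⁻¹ * (g ξ * φ ξ)) p volume :=
      hφg.2.of_le_mul
        ((((measurable_branchPow (-1) c α).comp Complex.measurable_ofReal).inv
          ).aestronglyMeasurable.mul hφg.2.1)
        (ae_of_all _ fun ξ => by
          rw [norm_mul]
          gcongr
          exact norm_inv_branchPow_le hs2 hα0.le (by simp))
    have heq : (fun ξ : ℝ => (branchPow (-1) c α ξ)⁻¹ * (g ξ * φ ξ)) =ᵐ[volume]
        fun ξ => f ξ * hkm.toLp _ ξ := by
      filter_upwards [hkφ, hg, ae_ne_const c] with ξ h1 h2 h3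
      have h3' : (ξ : ℂ) ≠ c := by exact_mod_cast h3
      have n1 := branchPow_ne_zero α hs1 (z := (ξ : ℂ)) (by simp) h3'
      have n2 := branchPow_ne_zero α hs2 (z := (ξ : ℂ)) (by simp) h3'
      rw [h1, h2, inv_mul_eq_iff_eq_mul₀ n2, ← rPow_mul_branchPow α h3]
      field_simp
    refine ⟨⟨hkm.toLp _, mem_toeplitzKer_iff.2 ⟨⟨⟨_, hk0.congr_ae hkφ.symm⟩, hgk0.ae_eq heq⟩,
      _, hfk0.congr_ae heq⟩, ?_⟩, hφg⟩
    filter_upwards [hkφ, ae_ne_const c] with ξ h1 h3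
    have h3' : (ξ : ℂ) ≠ c := by exact_mod_cast h3
    rw [h1, factorPow_eq_branchPow,
      mul_inv_cancel_left₀ (branchPow_ne_zero α hs1 (by simp) h3')]
  · obtain ⟨⟨k, hk, hφk⟩, hφg⟩ := hφ
    obtain ⟨hkf, K, hK⟩ := mem_toeplitzKer_iff.1 hk
    -- Here φ ∈ D(T_g) supplies the L_p hypothesis under which multiplying fk by the unbounded b₋
    -- stays in H⁻.
    have heq : (fun ξ : ℝ => g ξ * φ ξ) =ᵐ[volume]
        fun ξ => branchPow (-1) c α ξ * (f ξ * k ξ) := by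
      filter_upwards [hφk, hg, ae_ne_const c] with ξ h1 h2 h3
      rw [h1, h2, factorPow_eq_branchPow, ← rPow_mul_branchPow α h3]
      ring
    exact mem_toeplitzKer_iff.2 ⟨hφg, _, (hK.branchPow_mul hp1 hp hkf.2 hα0.le
      (hφg.2.ae_eq heq)).congr_ae heq.symm⟩
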